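/- Let $n\ge 2$ and $d\ge 2$. Let $C\subset\mathbb{R}^n$ be the set of all $(a_1,\dots,a_n)$ for which there is a real $n\times\cdots\times n$ tensor $T=(t_{i_1\dots i_d})$ of order $d$ and rank one, with nonnegative entries that sum to one, such that $t_{ii\dots i}=a_i$ for $i=1,\dots,n$; that is, $C$ is the set of diagonal partial tensors that can be completed to rank-one tensors in the standard simplex. Let $\partial C=\overline{C}\cap\overline{\mathbb{R}^n_{\ge 0}\setminus C}$ be the boundary of $C$ relative to the nonnegative orthant. Then there is a polynomial $f\in\mathbb{Q}[x_1,\dots,x_n]$ with the following properties. 1. $f$ is irreducible over $\mathbb{Q}$ and over $\mathbb{R}$, has constant term one, and vanishes on $\partial C$. For $K=\mathbb{Q}$ and for $K=\mathbb{R}$, $f$ is the only polynomial in $K[x_1,\dots,x_n]$ that is irreducible over $K$, has constant term one and vanishes on $\partial C$. 2. $f$ has total degree $d^{n-1}$. 3. $f=\prod\bigl((1-y_1-\cdots-y_{n-1})^d-x_n\bigr)$, where the product is over all choices of $d$-th roots $y_i$ of $x_i$, $1\le i\le n-1$. Precisely, for all $x\in\mathbb{C}^n$ and $y\in\mathbb{C}^{n-1}$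 with $y_i^d=x_i$ for $1\le i\le n-1$, $$f(x)=\prod_{\omega_1^d=\cdots=\omega_{n-1}^d=1}\bigl((1-\omega_1y_1-\cdots-\omega_{n-1}y_{n-1})^d-x_n\bigr),$$ where $\omega$ runs over all $(n-1)$-tuples of complex $d$-th roots of unity. 4. Call the connected components of $\{x\in\mathbb{R}^n_{\ge0}: f(x)>0\}$ the chambers of $f$, and let $U$ be the chamber that contains the origin. Then $C=\overline{U}$, and there are finitely many polynomials $g_1,\dots,g_k\in\mathbb{R}[x_1,\dots,x_n]$ such that $$C=\{x\in\mathbb{R}^n : f(x)\ge 0,\ x_1,\dots,x_n\ge 0,\ g_1(x)\ge0,\dots,g_k(x)\ge 0\},$$ where every $g_j$ is positive on $U$, and at each point of any other chamber some $g_j$ is negative. -/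

import Mathlib

open scoped BigOperators

/-- Real tensors of order `d` and format `n × ⋯ × n`. -/
abbrev RealTensor (d n : ℕ) : Type := (Fin d → Fin n) → ℝ

/-- A tensor has rank one if it is nonzero and an outer product `v 1 ⊗ ⋯ ⊗ v d` of vectors. -/
def RealTensor.IsRankOne {d n : ℕ} (T : RealTensor d n) : Prop :=
  T ≠ 0 ∧ ∃ v : Fin d → Fin n → ℝ, ∀ α : Fin d → Fin n, T α = ∏ j, v j (α j)

/-- The diagonal partial tensors (given by their diagonal entries `a i = t_{i i … i}`) that can be
completed to a rank-one tensor in the standard simplex, that is, to a rank-one tensor whose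
entries are nonnegative and sum to one. -/
def completableDiagonals (d n : ℕ) : Set (Fin n → ℝ) :=
  {a | ∃ T : RealTensor d n,
    T ∈ stdSimplex ℝ (Fin d → Fin n) ∧ T.IsRankOne ∧ ∀ i, T (fun _ => i) = a i}

/-- The boundary of the set of completable diagonals, relative to the nonnegative orthant
(`Set.Ici 0` is the orthant). -/
def completableBoundary (d n : ℕ) : Set (Fin n → ℝ) :=
  closure (completableDiagonals d n) ∩ closure (Set.Ici 0 \ completableDiagonals d n)

/-- `f`, with coefficients in a field `K` of real numbers, is irreducible over `K`, has constant
term one, and vanishes on the boundary of the set of completable diagonals. -/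
def IsBoundaryPolynomial (K : Type) [Field K] [Algebra K ℝ] (d : ℕ) {n : ℕ}
    (f : MvPolynomial (Fin n) K) : Prop :=
  Irreducible f ∧ MvPolynomial.constantCoeff f = 1 ∧
    ∀ x ∈ completableBoundary d n, MvPolynomial.aeval x f = 0

/-- The chamber of `f` at the origin: the connected component of `0` in the part of the
nonnegative orthant where `f > 0`. -/
def originChamber {n : ℕ} (f : MvPolynomial (Fin n) ℚ) : Set (Fin n → ℝ) :=
  connectedComponentIn {x | 0 ≤ x ∧ 0 < MvPolynomial.aeval x f} 0

/-! Everything rests on the description of C as the set of x ≥ 0 with ∑ x_i^{1/d} ≤ 1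
(`completableDiagonals_eq`): AM-GM gives the bound, and an explicit choice of factors gives
completions. The relative boundary is the level set where this root sum equals 1.

Put x_i = y_i^d. The boundary becomes the simplex ∑ y_i = 1, y ≥ 0, so g vanishes on it only if 1 -
∑ y_i divides g(y^d). As g(y^d) is invariant under multiplying the y_i by d-th roots of unity, all
the forms 1 - ∑ ω_i y_i, hence their product, then divide it. That product has the same invariance
and is Galois invariant, so it equals f(y^d) with f rational. Thus f divides g exactly when one
prime linear form divides g(y^d) (`dvd_iff_affineForm_dvd_expand`). Primality and uniqueness of f
follow, over ℚ and ℝ alike.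

For the inequalities, fix x ≥ 0 and let P(t) = t^D f(x/t) with D = d^m, a monic polynomial in t. Its
nonzero roots are d-th powers of sums ∑ ω_i x_i^{1/d}, so they have modulus at most S^d, where S is
the root sum; if S > 0, then S^d is itself a root. If S < 1, Gauss-Lucas keeps the roots of all
derivatives in the open unit disc, so P^{(k)}(1) > 0 for k < D. Conversely, if these numbers are
nonnegative, Taylor expansion at 1 rules out roots beyond 1, so S ≤ 1. The g_k are the polynomials
P^{(k)}(1) in x. -/

open MvPolynomial

/-! ### Descent of divisibility along x ↦ x^d and field extension -/

section Projection

/-- For an additive map `π : k → K` between commutative rings, every polynomial `q` over `k` has a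
companion over `K` that collects the images of the coefficients of `q` at multiples of `d`. -/
theorem exists_contract_coeff {σ k K : Type*} [CommRing k] [CommRing K] (π : k →+ K) {d : ℕ}
    (hd : d ≠ 0) (q : MvPolynomial σ k) :
    ∃ r : MvPolynomial σ K, ∀ α : σ →₀ ℕ, coeff α r = π (coeff (d • α) q) := by
  classical
  have hinj : Function.Injective fun α : σ →₀ ℕ => d • α := fun a b h => by
    ext i
    have := DFunLike.congr_fun h i
    simpa [hd] using this
  refine ⟨∑ α ∈ q.support.preimage (fun α => d • α) hinj.injOn, monomial α (π (coeff (d • α) q)),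
    fun α => ?_⟩
  rw [coeff_sum]
  simp only [coeff_monomial, Finset.sum_ite_eq', Finset.mem_preimage, mem_support_iff]
  split_ifs with h
  · rfl
  · rw [not_not.mp h, map_zero]

/-- Keeping only exponents divisible by d and projecting coefficients to K is linear over K[x],
acting through f ↦ f(x^d). So it turns a quotient over k into a quotient over K. -/
theorem coeff_contract_expand_mul {σ k K : Type*} [CommRing k] [CommRing K] (ι : K →+* k)
    (π : k →+ K) (hπ : ∀ c z, π (ι c * z) = c * π z) {d : ℕ} (hd : d ≠ 0)
    {q : MvPolynomial σ k} {r : MvPolynomial σ K}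
    (hr : ∀ α : σ →₀ ℕ, coeff α r = π (coeff (d • α) q)) (f : MvPolynomial σ K) (α : σ →₀ ℕ) :
    coeff α (f * r) = π (coeff (d • α) (expand d (map ι f) * q)) := by
  classical
  induction f using MvPolynomial.induction_on' with
  | monomial β c =>
    rw [map_monomial, expand_monomial, coeff_monomial_mul', coeff_monomial_mul']
    have hle : d • β ≤ d • α ↔ β ≤ α := by
      simp only [Finsupp.le_def, Finsupp.smul_apply, smul_eq_mul]
      exact forall_congr' fun i => Nat.mul_le_mul_left_iff (Nat.pos_of_ne_zero hd)
    have hsub : d • α - d • β = d • (α - β) := by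
      ext i
      simp [Nat.mul_sub]
    by_cases h : β ≤ α
    · rw [if_pos h, if_pos (hle.2 h), hπ, hsub, hr]
    · rw [if_neg h, if_neg (mt hle.1 h), map_zero]
  | add p q hp hq => rw [add_mul, coeff_add, hp, hq, map_add, map_add, add_mul, coeff_add, map_add]

theorem exists_projection {K k : Type*} [Field K] [Field k] (ι : K →+* k) :
    ∃ π : k →+ K, (∀ c z, π (ι c * z) = c * π z) ∧ ∀ c, π (ι c) = c := by
  let := ι.toAlgebra
  obtain ⟨g, hg⟩ := (Algebra.linearMap K k).exists_leftInverse_of_injective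
    (LinearMap.ker_eq_bot.2 ι.injective)
  have hsm : ∀ c z, g (ι c * z) = c * g z := fun c z => by
    have := g.map_smul c z
    rwa [Algebra.smul_def, smul_eq_mul] at this
  refine ⟨g.toAddMonoidHom, hsm, fun c => ?_⟩
  exact LinearMap.congr_fun hg c

theorem dvd_of_expand_map_dvd {σ K k : Type*} [Field K] [Field k] (ι : K →+* k) {d : ℕ}
    (hd : d ≠ 0) {f g : MvPolynomial σ K} (h : expand d (map ι f) ∣ expand d (map ι g)) :
    f ∣ g := by
  obtain ⟨q, hq⟩ := h
  obtain ⟨π, hπ, hπι⟩ := exists_projection ι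
  obtain ⟨r, hr⟩ := exists_contract_coeff π hd q
  refine ⟨r, ?_⟩
  ext α
  rw [coeff_contract_expand_mul ι π hπ hd hr, ← hq, coeff_expand_smul _ hd, coeff_map, hπι]

end Projection

/-! ### Linear forms and their primality -/

section AffineForm

variable {k : Type*} [Field k]

/-- The polynomial `1 - ∑ i, a i * X i`. -/
noncomputable def affineForm {n : ℕ} (a : Fin n → k) : MvPolynomial (Fin n) k :=
  1 - ∑ i, C (a i) * X i

theorem eval_affineForm {n : ℕ} (a x : Fin n → k) :
    eval x (affineForm a) = 1 - ∑ i, a i * x i := by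
  simp [affineForm]

theorem map_affineForm {k' : Type*} [Field k'] (j : k →+* k') {n : ℕ} (a : Fin n → k) :
    map j (affineForm a) = affineForm (fun i => j (a i)) := by
  simp [affineForm]

theorem affineForm_ne_zero {n : ℕ} (a : Fin n → k) : affineForm a ≠ 0 := fun h => by
  have := eval_affineForm a 0
  simp [h] at this

/-- The substitution that solves `affineForm a = 0` for the last variable. -/
noncomputable def solveLast {m : ℕ} (a : Fin (m + 1) → k) :
    MvPolynomial (Fin (m + 1)) k →ₐ[k] MvPolynomial (Fin (m + 1)) k :=
  aeval (Fin.snoc (fun i : Fin m => X i.castSucc)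
    (C (a (Fin.last m))⁻¹ * (1 - ∑ i : Fin m, C (a i.castSucc) * X i.castSucc)))

/-- Modulo the form, the last variable equals its solution, so `solveLast` induces the identity on
the quotient. The form thus generates the kernel of a homomorphism into a domain, which makes it
prime. -/
theorem affineForm_dvd_iff {m : ℕ} {a : Fin (m + 1) → k} (ha : a (Fin.last m) ≠ 0)
    (p : MvPolynomial (Fin (m + 1)) k) : affineForm a ∣ p ↔ solveLast a p = 0 := by
  have hC : (C (a (Fin.last m)) * C (a (Fin.last m))⁻¹ : MvPolynomial (Fin (m + 1)) k) = 1 := by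
    rw [← C_mul, mul_inv_cancel₀ ha, C_1]
  constructor
  · rintro ⟨q, rfl⟩
    rw [map_mul]
    convert zero_mul _
    simp only [affineForm, solveLast, map_sub, map_one, map_add, map_sum, map_mul, aeval_X, algHom_C,
      Fin.sum_univ_castSucc, Fin.snoc_castSucc, Fin.snoc_last, algebraMap_eq]
    linear_combination (-(1 - ∑ i : Fin m, C (a i.castSucc) * X i.castSucc)) * hC
  · intro h
    let I := Ideal.span {affineForm a}
    have key : (Ideal.Quotient.mkₐ k I).comp (solveLast a) = Ideal.Quotient.mkₐ k I := by
      refine MvPolynomial.algHom_ext fun i => ?_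
      induction i using Fin.lastCases with
      | last =>
        simp only [solveLast, AlgHom.comp_apply, aeval_X, Fin.snoc_last, Ideal.Quotient.mkₐ_eq_mk]
        rw [Ideal.Quotient.eq, Ideal.mem_span_singleton]
        refine ⟨C (a (Fin.last m))⁻¹, ?_⟩
        rw [affineForm, Fin.sum_univ_castSucc]
        linear_combination X (Fin.last m) * hC
      | cast i => simp [solveLast]
    have h2 := AlgHom.congr_fun key p
    rw [AlgHom.comp_apply, h, map_zero, Ideal.Quotient.mkₐ_eq_mk, eq_comm,
      Ideal.Quotient.eq_zero_iff_mem, Ideal.mem_span_singleton] at h2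
    exact h2

theorem prime_affineForm {m : ℕ} {a : Fin (m + 1) → k} (ha : a (Fin.last m) ≠ 0) :
    Prime (affineForm a) := by
  refine ⟨affineForm_ne_zero a, fun h => ?_, fun p q h => ?_⟩
  · have := (affineForm_dvd_iff ha 1).1 h.dvd
    simp at this
  · rw [affineForm_dvd_iff ha, map_mul, mul_eq_zero] at h
    rwa [affineForm_dvd_iff ha, affineForm_dvd_iff ha]

theorem not_affineForm_dvd_affineForm {n : ℕ} {a b : Fin n → k} (ha : ∀ i, a i ≠ 0)
    (hab : a ≠ b) : ¬ affineForm a ∣ affineForm b := by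
  obtain ⟨i, hi⟩ := Function.ne_iff.1 hab
  rintro ⟨q, hq⟩
  -- The form of `a` vanishes at this point of the i-th axis; the form of `b` does so only if `b i =
  -- a i`.
  have := congrArg (eval (Pi.single i (a i)⁻¹)) hq
  rw [map_mul, eval_affineForm, eval_affineForm] at this
  simp only [Pi.single_apply, mul_ite, mul_zero, Finset.sum_ite_eq', Finset.mem_univ, if_true,
    mul_inv_cancel₀ (ha i), sub_self, zero_mul, sub_eq_zero] at this
  exact hi (by have h := eq_mul_inv_iff_mul_eq₀ (ha i) |>.1 this; simpa using h)

theorem totalDegree_affineForm {m : ℕ} {a : Fin (m + 1) → k} (ha : a (Fin.last m) ≠ 0) :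
    (affineForm a).totalDegree = 1 := by
  classical
  refine le_antisymm ?_ ?_
  · refine (totalDegree_sub _ _).trans (max_le (by simp) ?_)
    refine totalDegree_finsetSum_le fun i _ => ?_
    exact (totalDegree_mul _ _).trans (by simp)
  · have hc : coeff (Finsupp.single (Fin.last m) 1) (affineForm a) = - a (Fin.last m) := by
      simp [affineForm, coeff_sum, coeff_C_mul, coeff_X, coeff_one, Finsupp.single_left_inj,
        (Finsupp.single_ne_zero.2 one_ne_zero).symm]
    have := le_totalDegree (p := affineForm a) (s := Finsupp.single (Fin.last m) 1)
      (by rw [mem_support_iff, hc]; simpa using ha)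
    simpa using this

theorem totalDegree_prod_of_isDomain {σ ι R : Type*} [CommRing R] [IsDomain R] (s : Finset ι)
    (f : ι → MvPolynomial σ R) (hf : ∀ i ∈ s, f i ≠ 0) :
    (∏ i ∈ s, f i).totalDegree = ∑ i ∈ s, (f i).totalDegree := by
  classical
  induction s using Finset.induction_on with
  | empty => simp
  | insert a s ha ih =>
    rw [Finset.prod_insert ha, Finset.sum_insert ha, totalDegree_mul_of_isDomain
      (hf a (by simp)) (Finset.prod_ne_zero_iff.2 fun i hi => hf i (by simp [hi])),
      ih fun i hi => hf i (by simp [hi])]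

end AffineForm

/-! ### The product over roots of unity and its rational model -/

section OrbitProduct

/-- Tuples of `d`-th roots of unity. -/
noncomputable abbrev rootTuples (k : Type*) [Field k] (d n : ℕ) : Finset (Fin n → k) :=
  Fintype.piFinset fun _ => Polynomial.nthRootsFinset d (1 : k)

/-- The product of the affine forms `1 - ∑ i, ω i * X i` over all tuples of `d`-th roots of
unity. -/
noncomputable def orbitProduct (k : Type*) [Field k] (d n : ℕ) : MvPolynomial (Fin n) k :=
  ∏ ω ∈ rootTuples k d n, affineForm ω

variable {k : Type*} [Field k] {d : ℕ}

theorem mem_rootTuples (hd : 0 < d) {n : ℕ} {ω : Fin n → k} :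
    ω ∈ rootTuples k d n ↔ ∀ i, ω i ^ d = 1 := by
  simp [rootTuples, Polynomial.mem_nthRootsFinset hd]

theorem ne_zero_of_mem_rootTuples (hd : 0 < d) {n : ℕ} {ω : Fin n → k}
    (h : ω ∈ rootTuples k d n) (i : Fin n) : ω i ≠ 0 := fun h0 => by
  have := (mem_rootTuples hd).1 h i
  rw [h0, zero_pow hd.ne'] at this
  exact zero_ne_one this

/-- Multiplication of the variables by scalars. -/
noncomputable def scaleVars {n : ℕ} (c : Fin n → k) :
    MvPolynomial (Fin n) k →ₐ[k] MvPolynomial (Fin n) k :=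
  aeval fun i => C (c i) * X i

theorem scaleVars_affineForm {n : ℕ} (c a : Fin n → k) :
    scaleVars c (affineForm a) = affineForm (fun i => a i * c i) := by
  simp [scaleVars, affineForm, algHom_C, mul_assoc]

theorem coeff_scaleVars {n : ℕ} (c : Fin n → k) (p : MvPolynomial (Fin n) k) (β : Fin n →₀ ℕ) :
    coeff β (scaleVars c p) = (∏ i, c i ^ β i) * coeff β p := by
  classical
  induction p using MvPolynomial.induction_on' with
  | monomial γ r =>
    have : scaleVars c (monomial γ r) = monomial γ (r * ∏ i, c i ^ γ i) := by
      rw [scaleVars, aeval_monomial, Finsupp.prod_fintype _ _ (by simp), monomial_eq,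
        Finsupp.prod_fintype _ _ (by simp)]
      simp only [mul_pow, Finset.prod_mul_distrib, C_mul, map_prod, C_pow, algebraMap_eq]
      ring
    rw [this, coeff_monomial, coeff_monomial]
    split_ifs with h
    · rw [h, mul_comm]
    · simp
  | add p q hp hq => rw [map_add, coeff_add, coeff_add, hp, hq, mul_add]

theorem scaleVars_expand {n : ℕ} {c : Fin n → k} (hc : ∀ i, c i ^ d = 1)
    (p : MvPolynomial (Fin n) k) : scaleVars c (expand d p) = expand d p := by
  rw [scaleVars, aeval_expand]
  have : ((fun i => C (c i) * X i : Fin n → MvPolynomial (Fin n) k)) ^ d = fun i => X i ^ d := by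
    funext i
    simp [mul_pow, ← C_pow, hc]
  rw [this]
  rfl

theorem scaleVars_orbitProduct (hd : 0 < d) {n : ℕ} {c : Fin n → k} (hc : ∀ i, c i ^ d = 1) :
    scaleVars c (orbitProduct k d n) = orbitProduct k d n := by
  have hc0 : ∀ i, c i ≠ 0 := ne_zero_of_mem_rootTuples hd ((mem_rootTuples hd).2 hc)
  rw [orbitProduct, map_prod]
  refine Finset.prod_nbij' (fun ω i => ω i * c i) (fun ω i => ω i * (c i)⁻¹) ?_ ?_ ?_ ?_ ?_
  · intro ω h
    rw [mem_rootTuples hd] at h ⊢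
    intro i
    rw [mul_pow, h, hc, one_mul]
  · intro ω h
    rw [mem_rootTuples hd] at h ⊢
    intro i
    rw [mul_pow, inv_pow, h, hc, inv_one, one_mul]
  · intro ω _
    funext i
    simp [hc0]
  · intro ω _
    funext i
    simp [hc0]
  · intro ω _
    exact scaleVars_affineForm c ω

/-- Scaling the single variable i by ζ fixes the product but multiplies this coefficient by ζ^(β i)
≠ 1. -/
theorem coeff_orbitProduct_of_not_dvd (hd : 0 < d) {ζ : k} (hζ : IsPrimitiveRoot ζ d) {n : ℕ}
    {β : Fin n →₀ ℕ} {i : Fin n} (h : ¬ d ∣ β i) : coeff β (orbitProduct k d n) = 0 := by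
  classical
  have h1 := coeff_scaleVars (Pi.mulSingle i ζ) (orbitProduct k d n) β
  rw [scaleVars_orbitProduct hd] at h1
  · have h2 : ∏ j, (Pi.mulSingle i ζ : Fin n → k) j ^ β j = ζ ^ β i := by
      rw [Finset.prod_eq_single i]
      · simp
      · intro j _ hj
        simp [Pi.mulSingle_eq_of_ne hj]
      · simp
    rw [h2] at h1
    by_contra h0
    exact h (hζ.dvd_of_pow_eq_one _ (mul_right_cancel₀ h0 (h1.symm.trans (one_mul _).symm)))
  · intro j
    by_cases hj : j = i
    · subst hj
      simp [hζ.pow_eq_one]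
    · simp [Pi.mulSingle_eq_of_ne hj]

/-- A field embedding permutes or transports the roots of unity. Applied to automorphisms it gives
Galois invariance; applied to an embedding into ℂ it transfers the result. -/
theorem map_orbitProduct (hd : 0 < d) {k' : Type*} [Field k'] (j : k →+* k') {ζ : k}
    (hζ : IsPrimitiveRoot ζ d) (n : ℕ) : map j (orbitProduct k d n) = orbitProduct k' d n := by
  have hζ' : IsPrimitiveRoot (j ζ) d := hζ.map_of_injective j.injective
  rw [orbitProduct, map_prod]
  refine Finset.prod_nbij (fun ω i => j (ω i)) ?_ ?_ ?_ ?_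
  · intro ω h
    rw [mem_rootTuples hd] at h ⊢
    intro i
    rw [← map_pow, h, map_one]
  · intro ω _ ω' _ h
    funext i
    exact j.injective (congrFun h i)
  · intro ω h
    have hω := (mem_rootTuples hd).1 (Finset.mem_coe.1 h)
    have : NeZero d := ⟨hd.ne'⟩
    have hex : ∀ i, ∃ e : ℕ, j (ζ ^ e) = ω i := fun i => by
      obtain ⟨e, -, he⟩ := hζ'.eq_pow_of_pow_eq_one (hω i)
      exact ⟨e, by rw [map_pow, he]⟩
    choose e he using hex
    refine ⟨fun i => ζ ^ e i, ?_, funext he⟩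
    rw [Finset.mem_coe, mem_rootTuples hd]
    intro i
    rw [← pow_mul, mul_comm, pow_mul, hζ.pow_eq_one, one_pow]
  · intro ω _
    exact map_affineForm j ω

theorem totalDegree_orbitProduct (hd : 0 < d) {ζ : k} (hζ : IsPrimitiveRoot ζ d) (m : ℕ) :
    (orbitProduct k d (m + 1)).totalDegree = d ^ (m + 1) := by
  rw [orbitProduct, totalDegree_prod_of_isDomain _ _ fun _ _ => affineForm_ne_zero _,
    Finset.sum_congr rfl fun ω hω => totalDegree_affineForm (ne_zero_of_mem_rootTuples hd hω _)]
  simp [rootTuples, hζ.card_nthRootsFinset]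

/-- Scaling by ω fixes a polynomial in the d-th powers and carries the form of 1 to that of ω.
Distinct forms are non-associated primes, so their product divides too. -/
theorem orbitProduct_dvd_expand (hd : 0 < d) {m : ℕ} {p : MvPolynomial (Fin (m + 1)) k}
    (h : affineForm 1 ∣ expand d p) : orbitProduct k d (m + 1) ∣ expand d p := by
  refine Finset.prod_dvd_of_isRelPrime ?_ fun ω hω => ?_
  · intro ω hω ω' _ hne
    have h0 := ne_zero_of_mem_rootTuples hd (Finset.mem_coe.1 hω)
    exact ((prime_affineForm (h0 _)).irreducible.isRelPrime_iff_not_dvd).2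
      (not_affineForm_dvd_affineForm h0 hne)
  · have := map_dvd (scaleVars ω) h
    rw [scaleVars_expand ((mem_rootTuples hd).1 hω), scaleVars_affineForm] at this
    simpa using this

theorem exists_expand_eq_orbitProduct_of_isGalois (Ω : Type*) [Field Ω] [IsAlgClosed Ω]
    [Algebra ℚ Ω] [IsGalois ℚ Ω] (hd : 0 < d) (n : ℕ) :
    ∃ f : MvPolynomial (Fin n) ℚ, expand d (map (algebraMap ℚ ℂ) f) = orbitProduct ℂ d n := by
  classical
  have : CharZero Ω := charZero_of_injective_algebraMap (algebraMap ℚ Ω).injective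
  have : NeZero d := ⟨hd.ne'⟩
  obtain ⟨ζ, hζ⟩ := HasEnoughRootsOfUnity.exists_primitiveRoot Ω d
  let ι := algebraMap ℚ Ω
  have hfix : ∀ β, ∃ c : ℚ, ι c = coeff β (orbitProduct Ω d n) := fun β => by
    refine (InfiniteGalois.mem_range_algebraMap_iff_fixed _).2 fun σ => ?_
    have := congrArg (coeff β) (map_orbitProduct hd (σ : Ω →+* Ω) hζ n)
    rwa [coeff_map] at this
  obtain ⟨π, -, hπι⟩ := exists_projection ι
  obtain ⟨f, hf⟩ := exists_contract_coeff π hd.ne' (orbitProduct Ω d n)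
  have h1 : expand d (map ι f) = orbitProduct Ω d n := by
    ext β
    by_cases h : ∀ i, d ∣ β i
    · obtain ⟨α, rfl⟩ : ∃ α : Fin n →₀ ℕ, β = d • α := by
        choose a ha using h
        exact ⟨Finsupp.equivFunOnFinite.symm a, by ext i; simp [ha]⟩
      obtain ⟨c, hc⟩ := hfix (d • α)
      rw [coeff_expand_smul _ hd.ne', coeff_map, hf, ← hc, hπι]
    · obtain ⟨i, hi⟩ := not_forall.1 h
      rw [coeff_expand_of_not_dvd _ hi, coeff_orbitProduct_of_not_dvd hd hζ hi]
  let j : Ω →ₐ[ℚ] ℂ := IsAlgClosed.lift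
  refine ⟨f, ?_⟩
  rw [← map_orbitProduct hd (j : Ω →+* ℂ) hζ n, ← h1, map_expand, map_map]
  exact congrArg (fun e => expand d (map e f)) j.comp_algebraMap.symm

theorem exists_rat_expand_eq_orbitProduct (hd : 0 < d) (n : ℕ) :
    ∃ f : MvPolynomial (Fin n) ℚ, expand d (map (algebraMap ℚ ℂ) f) = orbitProduct ℂ d n :=
  @exists_expand_eq_orbitProduct_of_isGalois d (AlgebraicClosure ℚ) _ _
    (AlgebraicClosure.instAlgebra ℚ) (@IsAlgClosure.isGalois ℚ (AlgebraicClosure ℚ) _ _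
      (AlgebraicClosure.instAlgebra ℚ) inferInstance _) hd n

theorem expand_map_constantCoeff {n : ℕ} {K : Type*} [Field K] (ι : K →+* k) (hd : 0 < d)
    {f : MvPolynomial (Fin n) K} (hf : expand d (map ι f) = orbitProduct k d n) :
    constantCoeff f = 1 := by
  apply ι.injective
  have h := congrArg constantCoeff hf
  rw [orbitProduct, map_prod, Finset.prod_eq_one] at h
  · rw [constantCoeff_eq, coeff_expand_zero _ hd.ne', coeff_map] at h
    rw [constantCoeff_eq, h, map_one]
  · intro ω _
    simp [affineForm]

section Descent

variable {K : Type*} [Field K] (ι : K →+* k) {m : ℕ} {f : MvPolynomial (Fin (m + 1)) K}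

theorem dvd_iff_affineForm_dvd_expand (hd : 0 < d)
    (hf : expand d (map ι f) = orbitProduct k d (m + 1)) (g : MvPolynomial (Fin (m + 1)) K) :
    f ∣ g ↔ affineForm 1 ∣ expand d (map ι g) := by
  constructor
  · rintro ⟨q, rfl⟩
    rw [map_mul, map_mul, hf]
    exact Dvd.dvd.mul_right (Finset.dvd_prod_of_mem _
      ((mem_rootTuples hd (ω := 1)).2 fun _ => one_pow d)) _
  · intro h
    refine dvd_of_expand_map_dvd ι hd.ne' ?_
    rw [hf]
    exact orbitProduct_dvd_expand hd h

/-- Divisibility by f is divisibility of the expansion by one prime form, and expansion is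
multiplicative. -/
theorem prime_of_expand_map_eq_orbitProduct (hd : 0 < d)
    (hf : expand d (map ι f) = orbitProduct k d (m + 1)) : Prime f := by
  have hp : Prime (affineForm (1 : Fin (m + 1) → k)) := prime_affineForm one_ne_zero
  refine ⟨?_, fun hu => ?_, fun a b hab => ?_⟩
  · rintro rfl
    simpa using expand_map_constantCoeff ι hd hf
  · have := (dvd_iff_affineForm_dvd_expand ι hd hf 1).1 hu.dvd
    rw [map_one, map_one] at this
    exact hp.not_isUnit (isUnit_of_dvd_one this)
  · rw [dvd_iff_affineForm_dvd_expand ι hd hf, map_mul, map_mul] at hab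
    rw [dvd_iff_affineForm_dvd_expand ι hd hf, dvd_iff_affineForm_dvd_expand ι hd hf]
    exact hp.dvd_or_dvd hab

end Descent

end OrbitProduct

/-- An irreducible polynomial with constant term one is determined by a divisor that is not a unit
and has constant term one. -/
theorem eq_of_dvd_of_irreducible {σ K : Type*} [Field K] {f g : MvPolynomial σ K}
    (hf : ¬ IsUnit f) (hf1 : constantCoeff f = 1) (hg : Irreducible g)
    (hg1 : constantCoeff g = 1) (h : f ∣ g) : g = f := by
  obtain ⟨u, hu⟩ := h
  have hunit := (hg.isUnit_or_isUnit hu).resolve_left hf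
  obtain ⟨c, -, rfl⟩ := (MvPolynomial.isUnit_iff_eq_C_of_isReduced).1 hunit
  have := congrArg constantCoeff hu
  rw [map_mul, hf1, hg1, constantCoeff_C, one_mul] at this
  rw [hu, ← this, C_1, mul_one]

/-- The values of `f` at `d`-th powers, if `f` expands to the orbit product. -/
theorem aeval_eq_prod_of_expand_eq {m d : ℕ} {f : MvPolynomial (Fin (m + 1)) ℚ}
    (hf : expand d (map (algebraMap ℚ ℂ) f) = orbitProduct ℂ d (m + 1))
    (y : Fin (m + 1) → ℂ) :
    aeval (fun i => y i ^ d) f = ∏ ω ∈ rootTuples ℂ d (m + 1), (1 - ∑ i, ω i * y i) := by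
  have h := congrArg (eval y) hf
  rw [eval_expand, eval_map, orbitProduct, map_prod] at h
  simp only [eval_affineForm] at h
  rw [← h]
  rfl

/-- The values of `f` in terms of `d`-th roots of all coordinates but the last. -/
theorem aeval_eq_prod_pow_sub {m d : ℕ} (hd : 0 < d) {f : MvPolynomial (Fin (m + 1)) ℚ}
    (hf : expand d (map (algebraMap ℚ ℂ) f) = orbitProduct ℂ d (m + 1))
    (x : Fin (m + 1) → ℂ) (y : Fin m → ℂ) (hy : ∀ i, y i ^ d = x i.castSucc) :
    aeval x f = ∏ ω ∈ Fintype.piFinset (fun _ : Fin m => Polynomial.nthRootsFinset d (1 : ℂ)),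
      ((1 - ∑ i, ω i * y i) ^ d - x (Fin.last m)) := by
  obtain ⟨z, hz⟩ := IsAlgClosed.exists_pow_nat_eq (x (Fin.last m)) hd
  have hx : x = fun i => (Fin.snoc y z : Fin (m + 1) → ℂ) i ^ d := by
    funext i
    induction i using Fin.lastCases with
    | last => simp [hz]
    | cast i => simp [hy]
  have hprim := Complex.isPrimitiveRoot_exp d hd.ne'
  conv_lhs => rw [hx]
  rw [aeval_eq_prod_of_expand_eq hf]
  -- The root of unity in the last slot is collected through A^d - z^d = ∏ (A - ξ z).
  have h2 : ∀ ω : Fin m → ℂ, (1 - ∑ i, ω i * y i) ^ d - x (Fin.last m) =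
      ∏ ξ ∈ Polynomial.nthRootsFinset d (1 : ℂ), ((1 - ∑ i, ω i * y i) - ξ * z) := fun ω => by
    rw [← hz, hprim.pow_sub_pow_eq_prod_sub_mul _ _ hd]
  simp only [h2]
  rw [← Finset.prod_product']
  refine Finset.prod_nbij' (fun ω => (Fin.init ω, ω (Fin.last m)))
    (fun p => (Fin.snoc p.1 p.2 : Fin (m + 1) → ℂ)) ?_ ?_ ?_ ?_ ?_
  · intro ω h
    simp only [Fintype.mem_piFinset, Finset.mem_product] at h ⊢
    exact ⟨fun i => h _, h _⟩
  · rintro ⟨ω, ξ⟩ h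
    simp only [Fintype.mem_piFinset, Finset.mem_product] at h ⊢
    intro i
    induction i using Fin.lastCases with
    | last => simpa using h.2
    | cast i => simpa using h.1 i
  · intro ω _
    simp
  · rintro ⟨ω, ξ⟩ _
    simp
  · intro ω _
    simp only [Fin.sum_univ_castSucc, Fin.snoc_castSucc, Fin.snoc_last, Fin.init]
    ring

/-! ### Completable diagonals, their boundary and the origin chamber -/

section RootSum

open Topology Filter

/-- The sum of the `d`-th roots of the coordinates. -/
noncomputable def rootSum (d : ℕ) {n : ℕ} (x : Fin n → ℝ) : ℝ :=
  ∑ i, x i ^ (d⁻¹ : ℝ)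

variable {d n : ℕ}

theorem continuous_rootSum (d n : ℕ) : Continuous (rootSum d (n := n)) :=
  continuous_finsetSum _ fun i _ =>
    (continuous_apply i).rpow_const fun _ => Or.inr (by positivity)

theorem rootSum_nonneg {x : Fin n → ℝ} (hx : 0 ≤ x) : 0 ≤ rootSum d x :=
  Finset.sum_nonneg fun i _ => Real.rpow_nonneg (hx i) _

theorem rootSum_smul {t : ℝ} (ht : 0 ≤ t) {x : Fin n → ℝ} (hx : 0 ≤ x) :
    rootSum d (t • x) = t ^ (d⁻¹ : ℝ) * rootSum d x := by
  simp only [rootSum, Pi.smul_apply, smul_eq_mul, Finset.mul_sum]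
  exact Finset.sum_congr rfl fun i _ => Real.mul_rpow ht (hx i)

theorem rootSum_zero (hd : d ≠ 0) : rootSum d (0 : Fin n → ℝ) = 0 := by
  simp [rootSum, Real.zero_rpow, hd]

theorem rootSum_pow (hd : d ≠ 0) {y : Fin n → ℝ} (hy : 0 ≤ y) :
    rootSum d (fun i => y i ^ d) = ∑ i, y i :=
  Finset.sum_congr rfl fun i _ => Real.pow_rpow_inv_natCast (hy i) hd

theorem rootSum_le_one_of_mem_completableDiagonals (hd : 0 < d) {a : Fin n → ℝ}
    (ha : a ∈ completableDiagonals d n) : 0 ≤ a ∧ rootSum d a ≤ 1 := by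
  classical
  obtain ⟨T, ⟨hT0, hT1⟩, ⟨-, v, hv⟩, hTa⟩ := ha
  refine ⟨fun i => by rw [← hTa]; exact hT0 _, ?_⟩
  -- The factors may have signs although T has none; absolute values give the same T. Dividing by
  -- the masses `P j`, whose product is 1, prepares AM-GM in each coordinate.
  let P : Fin d → ℝ := fun j => ∑ i, |v j i|
  have hP : ∏ j, P j = 1 := by
    rw [Finset.prod_univ_sum, Fintype.piFinset_univ, ← hT1]
    refine Finset.sum_congr rfl fun α _ => ?_
    rw [← Finset.abs_prod, ← hv, abs_of_nonneg (hT0 α)]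
  have hPpos : ∀ j, 0 < P j := fun j =>
    lt_of_le_of_ne (Finset.sum_nonneg fun i _ => abs_nonneg _) fun h => by
      rw [Finset.prod_eq_zero (Finset.mem_univ j) h.symm] at hP
      exact zero_ne_one hP
  have hai : ∀ i, a i = ∏ j, (|v j i| / P j) := fun i => by
    rw [Finset.prod_div_distrib, hP, div_one, ← Finset.abs_prod, ← hv fun _ => i, hTa,
      abs_of_nonneg]
    rw [← hTa]
    exact hT0 _
  have hle : ∀ i, a i ^ (d⁻¹ : ℝ) ≤ ∑ j, (d⁻¹ : ℝ) * (|v j i| / P j) := fun i => by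
    rw [hai, ← Real.finsetProd_rpow _ _ fun j _ => div_nonneg (abs_nonneg _) (hPpos j).le]
    refine Real.geom_mean_le_arith_mean_weighted _ _ _ (fun _ _ => by positivity) ?_
      fun j _ => div_nonneg (abs_nonneg _) (hPpos j).le
    simp [hd.ne']
  calc rootSum d a ≤ ∑ i, ∑ j, (d⁻¹ : ℝ) * (|v j i| / P j) := Finset.sum_le_sum fun i _ => hle i
    _ = ∑ j : Fin d, (d⁻¹ : ℝ) * (P j / P j) := by
      rw [Finset.sum_comm]
      refine Finset.sum_congr rfl fun j _ => ?_
      rw [← Finset.mul_sum, ← Finset.sum_div]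
    _ = 1 := by
      rw [Finset.sum_congr rfl fun j _ => by rw [div_self (hPpos j).ne', mul_one]]
      simp [hd.ne']

/-- Nonnegative factors with total mass one give a completion. -/
theorem mem_completableDiagonals_of_factors {v : Fin d → Fin n → ℝ} (hv : ∀ j, 0 ≤ v j)
    (h1 : ∏ j, ∑ i, v j i = 1) {a : Fin n → ℝ} (ha : ∀ i, ∏ j, v j i = a i) :
    a ∈ completableDiagonals d n := by
  classical
  have hsum : ∑ α : Fin d → Fin n, ∏ j, v j (α j) = 1 := by
    rw [← h1, Finset.prod_univ_sum, Fintype.piFinset_univ]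
  refine ⟨fun α => ∏ j, v j (α j), ⟨fun α => Finset.prod_nonneg fun j _ => hv j _, hsum⟩,
    ⟨fun h => ?_, v, fun _ => rfl⟩, ha⟩
  rw [Finset.sum_eq_zero fun α _ => congrFun h α] at hsum
  exact zero_ne_one hsum

/-- Two vectors with prescribed coordinatewise product and prescribed product of the masses. -/
theorem exists_mul_eq_sq_and_sum_mul_sum {m : ℕ} (hm : 1 ≤ m) {s : Fin (m + 1) → ℝ}
    (hs : ∀ i, 0 < s i) {c : ℝ} (hc : (∑ i, s i) ^ 2 ≤ c) :
    ∃ p q : Fin (m + 1) → ℝ, 0 ≤ p ∧ 0 ≤ q ∧ (∀ i, p i * q i = s i ^ 2) ∧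
      (∑ i, p i) * ∑ i, q i = c := by
  have hR : 0 < ∑ i : Fin m, s i.succ :=
    Finset.sum_pos (fun i _ => hs _) ⟨⟨0, hm⟩, Finset.mem_univ _⟩
  set R := ∑ i : Fin m, s i.succ
  have hs0 := hs 0
  have hc0 : 0 < c :=
    (pow_pos (Finset.sum_pos (fun i _ => hs i) ⟨0, by simp⟩) 2).trans_le hc
  rw [Fin.sum_univ_succ] at hc
  -- Replacing s₀ by s₀t in one factor and s₀/t in the other keeps the coordinatewise product. The
  -- product of masses is (∑ s)² at t = 1, and `B` is large enough that s₀BR ≥ c.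
  let h : ℝ → ℝ := fun t => (s 0 * t + R) * (s 0 / t + R)
  let B : ℝ := 1 + c / (s 0 * R)
  have hB : 1 ≤ B := by
    have : 0 ≤ c / (s 0 * R) := by positivity
    simp only [B]
    linarith
  have hcont : ContinuousOn h (Set.Icc 1 B) := by
    refine ContinuousOn.mul (by fun_prop) (ContinuousOn.add ?_ continuousOn_const)
    exact continuousOn_const.div continuousOn_id fun t ht => by
      have := ht.1
      positivity
  have hBc : c ≤ h B := by
    have h1 : c / (s 0 * R) ≤ B := by simp only [B]; linarith
    rw [div_le_iff₀ (by positivity)] at h1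
    have hBpos : 0 < B := by linarith
    have h2 : s 0 * B * R ≤ h B := by
      simp only [h]
      have : 0 ≤ s 0 / B := by positivity
      gcongr <;> nlinarith
    linarith
  obtain ⟨t, ht, hht⟩ := intermediate_value_Icc hB hcont
    (show c ∈ Set.Icc (h 1) (h B) from
      ⟨by simp only [h]; rw [mul_one, div_one, ← sq]; exact hc, hBc⟩)
  have ht0 : 0 < t := by linarith [ht.1]
  refine ⟨Fin.cons (s 0 * t) fun i => s i.succ, Fin.cons (s 0 / t) fun i => s i.succ,
    ?_, ?_, ?_, ?_⟩
  · intro i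
    refine Fin.cases ?_ (fun i => ?_) i
    · simp only [Fin.cons_zero, Pi.zero_apply]; positivity
    · simpa using (hs _).le
  · intro i
    refine Fin.cases ?_ (fun i => ?_) i
    · simp only [Fin.cons_zero, Pi.zero_apply]; positivity
    · simpa using (hs _).le
  · intro i
    refine Fin.cases ?_ (fun i => ?_) i
    · simp only [Fin.cons_zero]; field_simp
    · simp only [Fin.cons_succ]; ring
  · rw [Fin.sum_univ_succ, Fin.sum_univ_succ]
    simpa using hht

theorem mem_completableDiagonals_of_rootSum_le_one {m : ℕ} (hm : 1 ≤ m) (hd : 2 ≤ d)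
    {a : Fin (m + 1) → ℝ} (ha : 0 ≤ a) (hle : rootSum d a ≤ 1) :
    a ∈ completableDiagonals d (m + 1) := by
  classical
  obtain ⟨e, rfl⟩ := Nat.exists_eq_add_of_le' hd
  -- Two factors are adjusted to bring the total mass to 1; the other e = d - 2 are equal.
  suffices h : ∃ p q r : Fin (m + 1) → ℝ, 0 ≤ p ∧ 0 ≤ q ∧ 0 ≤ r ∧
      (∀ i, p i * q i * r i ^ e = a i) ∧ (∑ i, p i) * (∑ i, q i) * (∑ i, r i) ^ e = 1 by
    obtain ⟨p, q, r, hp, hq, hr, hpqr, hsum⟩ := h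
    refine mem_completableDiagonals_of_factors
      (v := Fin.cons p (Fin.cons q fun _ : Fin e => r)) ?_ ?_ ?_
    · intro j
      refine Fin.cases hp (fun j => ?_) j
      exact Fin.cases hq (fun j => hr) j
    · simpa [Fin.prod_univ_succ, mul_assoc] using hsum
    · intro i
      simpa [Fin.prod_univ_succ, mul_assoc] using hpqr i
  let s : Fin (m + 1) → ℝ := fun i => a i ^ (((e + 2 : ℕ) : ℝ)⁻¹)
  have hs0 : 0 ≤ s := fun i => Real.rpow_nonneg (ha i) _
  have hsa : ∀ i, s i ^ 2 * s i ^ e = a i := fun i => by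
    rw [← pow_add, add_comm 2 e]
    exact Real.rpow_inv_natCast_pow (ha i) (by omega)
  have hS1 : ∑ i, s i ≤ 1 := hle
  have hS0 : 0 ≤ ∑ i, s i := Finset.sum_nonneg fun i _ => hs0 i
  rcases hS0.eq_or_lt with hS | hS
  · have hsz : ∀ i, s i = 0 := fun i =>
      (Finset.sum_eq_zero_iff_of_nonneg fun i _ => hs0 i).1 hS.symm i (Finset.mem_univ i)
    have haz : ∀ i, a i = 0 := fun i => by rw [← hsa, hsz]; simp
    have hne : (0 : Fin (m + 1)) ≠ Fin.last m := fun h => by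
      have := congrArg Fin.val h
      simp only [Fin.val_zero, Fin.val_last] at this
      omega
    -- Disjoint supports of p and q make the diagonal zero.
    refine ⟨Pi.single 0 1, Pi.single (Fin.last m) 1, Pi.single 0 1, ?_, ?_, ?_, fun i => ?_, ?_⟩
    · exact Pi.single_nonneg.2 zero_le_one
    · exact Pi.single_nonneg.2 zero_le_one
    · exact Pi.single_nonneg.2 zero_le_one
    · rw [haz]
      by_cases h : i = 0
      · subst h
        simp [Pi.single_eq_of_ne hne]
      · simp [Pi.single_eq_of_ne h]
    · simp
  by_cases hz : ∃ i, s i = 0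
  · obtain ⟨i₀, hi₀⟩ := hz
    have hpow : (∑ i, s i) ^ (e + 1) * ∑ i, s i ≤ 1 := by
      rw [← pow_succ]
      exact pow_le_one₀ hS0 hS1
    have hx : 0 ≤ 1 / (∑ i, s i) ^ (e + 1) - ∑ i, s i := by
      rw [sub_nonneg, le_div_iff₀ (by positivity), mul_comm]
      exact hpow
    -- At a zero coordinate, mass added to one factor does not change the diagonal.
    refine ⟨s + Pi.single i₀ (1 / (∑ i, s i) ^ (e + 1) - ∑ i, s i), s, s,
      add_nonneg hs0 (Pi.single_nonneg.2 hx), hs0, hs0, fun i => ?_, ?_⟩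
    · rw [← hsa]
      by_cases h : i = i₀
      · subst h
        simp [hi₀]
      · simp [Pi.single_eq_of_ne h, sq]
    · simp only [Pi.add_apply, Finset.sum_add_distrib, Finset.sum_pi_single', Finset.mem_univ,
        if_true]
      field_simp
      ring
  · have hspos : ∀ i, 0 < s i := fun i => lt_of_le_of_ne (hs0 i) fun h => hz ⟨i, h.symm⟩
    obtain ⟨p, q, hp, hq, hpq, hsum⟩ := exists_mul_eq_sq_and_sum_mul_sum hm hspos
      (c := 1 / (∑ i, s i) ^ e) (by
        rw [le_div_iff₀ (by positivity), ← pow_add]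
        exact pow_le_one₀ hS0 hS1)
    refine ⟨p, q, s, hp, hq, hs0, fun i => by rw [hpq, hsa], ?_⟩
    rw [hsum]
    field_simp

theorem completableDiagonals_eq {m : ℕ} (hm : 1 ≤ m) (hd : 2 ≤ d) :
    completableDiagonals d (m + 1) = {x | 0 ≤ x ∧ rootSum d x ≤ 1} :=
  Set.ext fun _ => ⟨rootSum_le_one_of_mem_completableDiagonals (by omega),
    fun h => mem_completableDiagonals_of_rootSum_le_one hm hd h.1 h.2⟩

theorem isClosed_rootSum_le_one (d n : ℕ) :
    IsClosed {x : Fin n → ℝ | 0 ≤ x ∧ rootSum d x ≤ 1} :=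
  (isClosed_Ici (a := (0 : Fin n → ℝ))).inter
    (isClosed_le (continuous_rootSum d n) continuous_const)

theorem mem_closure_of_Iio_smul {x : Fin n → ℝ} {s : Set (Fin n → ℝ)}
    (h : ∀ t : ℝ, 0 < t → t < 1 → t • x ∈ s) : x ∈ closure s := by
  have hc : Tendsto (fun t : ℝ => t • x) (𝓝[<] 1) (𝓝 x) := by
    have : Continuous fun t : ℝ => t • x := by fun_prop
    simpa using (this.tendsto 1).mono_left nhdsWithin_le_nhds
  refine mem_closure_of_tendsto hc ?_
  filter_upwards [Ioo_mem_nhdsLT (zero_lt_one (α := ℝ))] with t ht using h t ht.1 ht.2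

theorem mem_closure_of_Ioi_smul {x : Fin n → ℝ} {s : Set (Fin n → ℝ)}
    (h : ∀ t : ℝ, 1 < t → t • x ∈ s) : x ∈ closure s := by
  have hc : Tendsto (fun t : ℝ => t • x) (𝓝[>] 1) (𝓝 x) := by
    have : Continuous fun t : ℝ => t • x := by fun_prop
    simpa using (this.tendsto 1).mono_left nhdsWithin_le_nhds
  refine mem_closure_of_tendsto hc ?_
  filter_upwards [self_mem_nhdsWithin] with t ht using h t ht

theorem completableBoundary_eq {m : ℕ} (hm : 1 ≤ m) (hd : 2 ≤ d) :
    completableBoundary d (m + 1) = {x | 0 ≤ x ∧ rootSum d x = 1} := by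
  have hd0 : (0 : ℝ) < d := by exact_mod_cast (show 0 < d by omega)
  rw [completableBoundary, completableDiagonals_eq hm hd,
    (isClosed_rootSum_le_one d (m + 1)).closure_eq]
  ext x
  constructor
  · rintro ⟨⟨hx, hx1⟩, hx2⟩
    refine ⟨hx, le_antisymm hx1 ?_⟩
    have hcl : IsClosed {x : Fin (m + 1) → ℝ | 1 ≤ rootSum d x} :=
      isClosed_le continuous_const (continuous_rootSum d _)
    refine closure_minimal (fun y hy => ?_) hcl hx2
    exact (not_le.1 fun h => hy.2 ⟨hy.1, h⟩).le
  · rintro ⟨hx, hx1⟩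
    refine ⟨⟨hx, hx1.le⟩, mem_closure_of_Ioi_smul fun t ht => ?_⟩
    have ht0 : 0 ≤ t := by linarith
    refine ⟨smul_nonneg ht0 hx, fun h => ?_⟩
    have h2 := h.2
    rw [rootSum_smul ht0 hx, hx1, mul_one] at h2
    exact absurd (Real.one_lt_rpow ht (by positivity)) (not_lt.2 h2)

theorem closure_rootSum_lt_one (hd : 0 < d) :
    closure {x : Fin n → ℝ | 0 ≤ x ∧ rootSum d x < 1} = {x | 0 ≤ x ∧ rootSum d x ≤ 1} := by
  refine Set.Subset.antisymm (closure_minimal (fun x hx => ⟨hx.1, hx.2.le⟩)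
    (isClosed_rootSum_le_one d n)) fun x hx => mem_closure_of_Iio_smul fun t ht0 ht1 => ?_
  refine ⟨smul_nonneg ht0.le hx.1, ?_⟩
  rw [rootSum_smul ht0.le hx.1]
  have : t ^ (d⁻¹ : ℝ) < 1 := Real.rpow_lt_one ht0.le ht1 (by positivity)
  nlinarith [hx.2, rootSum_nonneg (d := d) hx.1, Real.rpow_nonneg ht0.le (d⁻¹ : ℝ)]

/-- If `f` is positive where the root sum is less than one and vanishes where it is one, then the
chamber at the origin is given by the root sum. -/
theorem originChamber_eq (hd : 0 < d) {f : MvPolynomial (Fin n) ℚ}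
    (hpos : ∀ x : Fin n → ℝ, 0 ≤ x → rootSum d x < 1 → 0 < MvPolynomial.aeval x f)
    (hzero : ∀ x : Fin n → ℝ, 0 ≤ x → rootSum d x = 1 → MvPolynomial.aeval x f = 0) :
    originChamber f = {x | 0 ≤ x ∧ rootSum d x < 1} := by
  have h0 : rootSum d (0 : Fin n → ℝ) = 0 := rootSum_zero hd.ne'
  have h0mem : (0 : Fin n → ℝ) ∈ {x : Fin n → ℝ | 0 ≤ x ∧ 0 < MvPolynomial.aeval x f} :=
    ⟨le_rfl, hpos 0 le_rfl (by rw [h0]; exact zero_lt_one)⟩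
  have h0mem' : (0 : Fin n → ℝ) ∈ {x : Fin n → ℝ | 0 ≤ x ∧ rootSum d x < 1} :=
    ⟨le_rfl, by rw [h0]; exact zero_lt_one⟩
  refine Set.Subset.antisymm (fun x hx => ?_) ?_
  · have hsub := connectedComponentIn_subset {x : Fin n → ℝ | 0 ≤ x ∧ 0 < MvPolynomial.aeval x f} 0
    refine ⟨(hsub hx).1, not_le.1 fun h => ?_⟩
    -- A connected set reaching root sum ≥ 1 from 0 meets the level 1, where f vanishes.
    obtain ⟨y, hy, hy1⟩ := isPreconnected_connectedComponentIn.intermediate_value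
      (mem_connectedComponentIn h0mem) hx (continuous_rootSum d n).continuousOn
      (show (1 : ℝ) ∈ Set.Icc _ _ from ⟨by rw [h0]; exact zero_le_one, h⟩)
    have := (hsub hy).2
    rw [hzero y (hsub hy).1 hy1] at this
    exact lt_irrefl _ this
  · have hstar : StarConvex ℝ 0 {x : Fin n → ℝ | 0 ≤ x ∧ rootSum d x < 1} := by
      refine starConvex_zero_iff.2 fun x hx t ht0 ht1 => ⟨smul_nonneg ht0 hx.1, ?_⟩
      rw [rootSum_smul ht0 hx.1]
      have : t ^ (d⁻¹ : ℝ) ≤ 1 := Real.rpow_le_one ht0 ht1 (by positivity)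
      nlinarith [hx.2, rootSum_nonneg (d := d) hx.1, Real.rpow_nonneg ht0 (d⁻¹ : ℝ)]
    exact ((hstar.isPathConnected h0mem').isConnected.isPreconnected).subset_connectedComponentIn
      h0mem' fun x hx => ⟨hx.1, hpos x hx.1 hx.2⟩

end RootSum

/-! ### Real polynomials with roots in the unit disc -/

open Polynomial in
theorem Polynomial.eval_one_pos_of_forall_root_norm_lt_one {P : ℝ[X]} (hP : 0 < P.leadingCoeff)
    (hroot : ∀ z : ℂ, aeval z P = 0 → ‖z‖ < 1) : 0 < P.eval 1 := by
  by_contra hle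
  rw [not_lt] at hle
  have hdeg : 0 < P.degree := by
    by_contra h
    rw [eq_C_of_degree_le_zero (not_lt.1 h)] at hle hP
    simp only [eval_C, leadingCoeff_C] at hle hP
    exact absurd hP (not_lt.2 hle)
  obtain ⟨b, hb1, hb⟩ := ((tendsto_atTop_of_leadingCoeff_nonneg P hdeg hP.le).eventually_ge_atTop
    0 |>.and (Filter.eventually_ge_atTop 1)).exists.imp fun _ h => And.intro h.2 h.1
  obtain ⟨t, ht, ht0⟩ := intermediate_value_Icc hb1 P.continuous.continuousOn ⟨hle, hb⟩
  have := hroot t (by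
    rw [← Complex.coe_algebraMap, aeval_algebraMap_apply_eq_algebraMap_eval]
    exact (congrArg _ ht0).trans (map_zero _))
  rw [Complex.norm_real, Real.norm_eq_abs, abs_lt] at this
  exact absurd this.2 (not_lt.2 ht.1)

open Polynomial in
/-- A real polynomial with all complex roots in the open unit disc and positive leading coefficient
has positive derivatives at one. -/
theorem Polynomial.eval_one_iterate_derivative_pos (k : ℕ) {P : ℝ[X]} (hP : 0 < P.leadingCoeff)
    (hk : k ≤ P.natDegree) (hroot : ∀ z : ℂ, aeval z P = 0 → ‖z‖ < 1) :
    0 < (derivative^[k] P).eval 1 := by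
  induction k generalizing P with
  | zero => exact eval_one_pos_of_forall_root_norm_lt_one hP hroot
  | succ k ih =>
    rw [Function.iterate_succ_apply]
    refine ih ?_ ?_ fun z hz => ?_
    · rw [leadingCoeff_derivative]
      have : (0 : ℝ) < P.natDegree := by exact_mod_cast (show 0 < P.natDegree by omega)
      positivity
    · rw [natDegree_derivative]
      omega
    · let Q : ℂ[X] := P.map (algebraMap ℝ ℂ)
      have hQ : 0 < Q.degree := by
        rw [degree_map, ← natDegree_pos_iff_degree_pos]
        omega
      have hz' : z ∈ Q.derivative.rootSet ℂ := by
        rw [mem_rootSet, derivative_map]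
        refine ⟨?_, by simpa using hz⟩
        rw [Polynomial.map_ne_zero_iff (algebraMap ℝ ℂ).injective]
        intro h0
        have := derivative_eq_zero.1 h0
        omega
      have hsub : Q.rootSet ℂ ⊆ Metric.ball 0 1 := fun w hw => by
        rw [mem_ball_zero_iff]
        refine hroot w ?_
        have := (mem_rootSet.1 hw).2
        simpa [Q] using this
      -- Gauss-Lucas.
      have := convexHull_min hsub (convex_ball 0 1)
        (rootSet_derivative_subset_convexHull_rootSet hQ hz')
      rwa [mem_ball_zero_iff] at this

open Polynomial in
/-- A monic real polynomial with nonnegative derivatives at one is positive beyond one. -/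
theorem Polynomial.eval_pos_of_iterate_derivative_nonneg {P : ℝ[X]} (hP : P.Monic)
    (h : ∀ k < P.natDegree, 0 ≤ (derivative^[k] P).eval 1) {t : ℝ} (ht : 1 < t) :
    0 < P.eval t := by
  -- The Taylor coefficients at 1 are the derivatives there divided by k!.
  have hc : ∀ k < P.natDegree, 0 ≤ (taylor 1 P).coeff k := fun k hk => by
    have h1 := h k hk
    rw [← factorial_smul_hasseDeriv] at h1
    rw [LinearMap.smul_apply, eval_smul, nsmul_eq_mul] at h1
    rw [taylor_coeff]
    exact nonneg_of_mul_nonneg_right h1 (by exact_mod_cast k.factorial_pos)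
  have hlead : (taylor 1 P).coeff P.natDegree = 1 := by
    rw [← natDegree_taylor P 1, coeff_natDegree, leadingCoeff_taylor, hP.leadingCoeff]
  have hval : P.eval t = (taylor 1 P).eval (t - 1) := by rw [taylor_eval_sub]
  rw [hval, eval_eq_sum_range, natDegree_taylor, Finset.sum_range_succ, hlead, one_mul]
  have hpos : 0 < (t - 1) ^ P.natDegree := pow_pos (by linarith) _
  have hs : 0 ≤ ∑ i ∈ Finset.range P.natDegree, (taylor 1 P).coeff i * (t - 1) ^ i :=
    Finset.sum_nonneg fun i hi =>
      mul_nonneg (hc i (Finset.mem_range.1 hi)) (pow_nonneg (by linarith) _)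
  linarith

theorem MvPolynomial.totalDegree_map_of_injective {σ R S : Type*} [CommSemiring R]
    [CommSemiring S] {j : R →+* S} (hj : Function.Injective j) (p : MvPolynomial σ R) :
    (map j p).totalDegree = p.totalDegree := by
  rw [totalDegree, totalDegree, support_map_of_injective _ hj]

/-! ### The radial polynomial t^D f(x/t) -/

section Radial

variable {n : ℕ}

/-- The homogenization of degree `D` of `f`, as a polynomial in the additional variable. -/
noncomputable def radialPoly (D : ℕ) (f : MvPolynomial (Fin n) ℝ) :
    Polynomial (MvPolynomial (Fin n) ℝ) :=
  ∑ α ∈ f.support, Polynomial.C (monomial α (coeff α f)) *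
    Polynomial.X ^ (D - α.sum fun _ e => e)

theorem map_eval_radialPoly (D : ℕ) (f : MvPolynomial (Fin n) ℝ) (x : Fin n → ℝ) :
    (radialPoly D f).map (eval x) = ∑ α ∈ f.support,
      Polynomial.C (coeff α f * ∏ i, x i ^ α i) * Polynomial.X ^ (D - α.sum fun _ e => e) := by
  simp [radialPoly, Polynomial.map_sum, eval_monomial, Finsupp.prod_fintype]

theorem aeval_radialPoly {D : ℕ} {f : MvPolynomial (Fin n) ℝ} (hD : f.totalDegree ≤ D)
    (x : Fin n → ℝ) {z : ℂ} (hz : z ≠ 0) :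
    Polynomial.aeval z ((radialPoly D f).map (eval x)) =
      z ^ D * aeval (fun i => (x i : ℂ) / z) f := by
  rw [map_eval_radialPoly, map_sum]
  conv_rhs => rw [aeval_def, eval₂_eq', Finset.mul_sum]
  refine Finset.sum_congr rfl fun α hα => ?_
  -- The degree bound makes the exponent D - |α| a genuine subtraction.
  have hle : (α.sum fun _ e => e) ≤ D := (le_totalDegree hα).trans hD
  have hsum : (α.sum fun _ e => e) = ∑ i, α i := Finsupp.sum_fintype _ _ (by simp)
  rw [hsum] at hle ⊢
  simp only [map_mul, Polynomial.aeval_C, map_prod, map_pow, Polynomial.aeval_X,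
    Complex.coe_algebraMap, div_pow, Finset.prod_div_distrib, Finset.prod_pow_eq_pow_sum]
  rw [pow_sub₀ z hz hle]
  ring

theorem monic_radialPoly {D : ℕ} (hD : 0 < D) {f : MvPolynomial (Fin n) ℝ}
    (hf : constantCoeff f = 1) (x : Fin n → ℝ) :
    ((radialPoly D f).map (eval x)).Monic ∧
      ((radialPoly D f).map (eval x)).natDegree = D := by
  have hc : ((radialPoly D f).map (eval x)).coeff D = 1 := by
    rw [map_eval_radialPoly, Polynomial.finsetSum_coeff, Finset.sum_eq_single 0]
    · rw [constantCoeff_eq] at hf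
      simp [hf]
    · intro α _ hα
      rw [Polynomial.coeff_C_mul_X_pow, if_neg]
      have : (α.sum fun _ e => e) ≠ 0 := fun h => hα <| by
        rw [Finsupp.sum_fintype _ _ (by simp), Finset.sum_eq_zero_iff] at h
        ext i
        exact h i (Finset.mem_univ i)
      omega
    · intro h
      rw [constantCoeff_eq] at hf
      rw [notMem_support_iff.1 h] at hf
      exact absurd hf zero_ne_one
  have hdeg : ((radialPoly D f).map (eval x)).natDegree ≤ D := by
    rw [map_eval_radialPoly]
    refine Polynomial.natDegree_sum_le_of_forall_le _ _ fun α _ => ?_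
    exact (Polynomial.natDegree_C_mul_X_pow_le _ _).trans (Nat.sub_le _ _)
  have heq := le_antisymm hdeg (Polynomial.le_natDegree_of_ne_zero (by rw [hc]; exact one_ne_zero))
  exact ⟨by rw [Polynomial.Monic, Polynomial.leadingCoeff, heq, hc], heq⟩

/-- The `k`-th derivative at one of `radialPoly D f`. -/
noncomputable def radialDerivative (D : ℕ) (f : MvPolynomial (Fin n) ℝ) (k : ℕ) :
    MvPolynomial (Fin n) ℝ :=
  (Polynomial.derivative^[k] (radialPoly D f)).eval 1

theorem eval_radialDerivative (D : ℕ) (f : MvPolynomial (Fin n) ℝ) (k : ℕ) (x : Fin n → ℝ) :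
    eval x (radialDerivative D f k) =
      (Polynomial.derivative^[k] ((radialPoly D f).map (eval x))).eval 1 := by
  rw [radialDerivative, Polynomial.iterate_derivative_map, Polynomial.eval_one_map]

end Radial

/-! ### Roots of the radial polynomial and the root sum -/

section OrbitPolynomial

variable {m d : ℕ} {f : MvPolynomial (Fin (m + 1)) ℚ}

theorem aeval_ofReal_eq_prod
    (hf : expand d (map (algebraMap ℚ ℂ) f) = orbitProduct ℂ d (m + 1)) (hd : 0 < d)
    {x : Fin (m + 1) → ℝ} (hx : 0 ≤ x) {τ : ℂ} :
    aeval (fun i => (x i : ℂ) / τ ^ d) f =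
      ∏ ω ∈ rootTuples ℂ d (m + 1), (1 - ∑ i, ω i * (((x i ^ (d⁻¹ : ℝ) : ℝ) : ℂ) / τ)) := by
  rw [← aeval_eq_prod_of_expand_eq hf]
  congr 1
  congr 1
  funext i
  rw [div_pow, ← Complex.ofReal_pow, Real.rpow_inv_natCast_pow (hx i) hd.ne']

theorem aeval_eq_zero_of_rootSum_eq_one
    (hf : expand d (map (algebraMap ℚ ℂ) f) = orbitProduct ℂ d (m + 1)) (hd : 0 < d)
    {x : Fin (m + 1) → ℝ} (hx : 0 ≤ x) (h1 : rootSum d x = 1) : aeval x f = 0 := by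
  have h := aeval_ofReal_eq_prod hf hd hx (τ := 1)
  rw [Finset.prod_eq_zero (i := 1) ((mem_rootTuples hd).2 fun _ => one_pow d)] at h
  · simp only [one_pow, div_one] at h
    have h2 := aeval_algebraMap_apply ℂ x f
    exact (algebraMap ℝ ℂ).injective ((h2.symm.trans h).trans (map_zero _).symm)
  · simp only [Pi.one_apply, one_mul, div_one]
    rw [← Complex.ofReal_sum]
    change 1 - ((rootSum d x : ℝ) : ℂ) = 0
    rw [h1, Complex.ofReal_one, sub_self]

/-- A vanishing factor forces τ = ∑ ω_i x_i^{1/d}; the triangle inequality does the rest. -/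
theorem norm_pow_root_le_rootSum
    (hf : expand d (map (algebraMap ℚ ℂ) f) = orbitProduct ℂ d (m + 1)) (hd : 0 < d)
    {x : Fin (m + 1) → ℝ} (hx : 0 ≤ x) {τ : ℂ} (hτ : τ ≠ 0)
    (h : aeval (fun i => (x i : ℂ) / τ ^ d) f = 0) : ‖τ‖ ≤ rootSum d x := by
  rw [aeval_ofReal_eq_prod hf hd hx, Finset.prod_eq_zero_iff] at h
  obtain ⟨ω, hω, h⟩ := h
  have hτe : τ = ∑ i, ω i * ((x i ^ (d⁻¹ : ℝ) : ℝ) : ℂ) := by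
    simp only [← mul_div_assoc] at h
    rw [← Finset.sum_div, sub_eq_zero, eq_comm, div_eq_one_iff_eq hτ] at h
    exact h.symm
  rw [hτe]
  refine (norm_sum_le _ _).trans (Finset.sum_le_sum fun i _ => ?_)
  have hω1 : ‖ω i‖ = 1 := Complex.norm_eq_one_of_pow_eq_one ((mem_rootTuples hd).1 hω i) hd.ne'
  rw [norm_mul, hω1, one_mul, Complex.norm_real, Real.norm_of_nonneg (Real.rpow_nonneg (hx i) _)]

theorem totalDegree_eq_of_expand_eq_orbitProduct
    (hf : expand d (map (algebraMap ℚ ℂ) f) = orbitProduct ℂ d (m + 1)) (hd : 0 < d) :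
    f.totalDegree = d ^ m := by
  have h := congrArg totalDegree hf
  rw [totalDegree_expand, totalDegree_orbitProduct hd (Complex.isPrimitiveRoot_exp d hd.ne'),
    totalDegree_map_of_injective (algebraMap ℚ ℂ).injective, pow_succ] at h
  exact Nat.eq_of_mul_eq_mul_right hd h

theorem norm_lt_one_of_aeval_radialPoly_eq_zero
    (hf : expand d (map (algebraMap ℚ ℂ) f) = orbitProduct ℂ d (m + 1)) (hd : 0 < d)
    {x : Fin (m + 1) → ℝ} (hx : 0 ≤ x) (hlt : rootSum d x < 1) (z : ℂ)
    (hz : Polynomial.aeval z ((radialPoly (d ^ m) (map (algebraMap ℚ ℝ) f)).map (eval x)) = 0) :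
    ‖z‖ < 1 := by
  rcases eq_or_ne z 0 with rfl | hz0
  · simp
  obtain ⟨τ, rfl⟩ := IsAlgClosed.exists_pow_nat_eq z hd
  have hτ : τ ≠ 0 := by
    rintro rfl
    exact hz0 (zero_pow hd.ne')
  rw [aeval_radialPoly ((totalDegree_map_of_injective (algebraMap ℚ ℝ).injective f).le.trans
    (totalDegree_eq_of_expand_eq_orbitProduct hf hd).le) x hz0, mul_eq_zero,
    or_iff_right (pow_ne_zero _ hz0), aeval_map_algebraMap] at hz
  rw [norm_pow]
  exact pow_lt_one₀ (norm_nonneg _)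
    ((norm_pow_root_le_rootSum hf hd hx hτ hz).trans_lt hlt) hd.ne'

theorem constantCoeff_map_eq_one
    (hf : expand d (map (algebraMap ℚ ℂ) f) = orbitProduct ℂ d (m + 1)) (hd : 0 < d) :
    constantCoeff (map (algebraMap ℚ ℝ) f) = 1 := by
  rw [constantCoeff_map, expand_map_constantCoeff _ hd hf, map_one]

theorem eval_radialDerivative_pos
    (hf : expand d (map (algebraMap ℚ ℂ) f) = orbitProduct ℂ d (m + 1)) (hd : 0 < d)
    {x : Fin (m + 1) → ℝ} (hx : 0 ≤ x) (hlt : rootSum d x < 1) {k : ℕ} (hk : k < d ^ m) :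
    0 < eval x (radialDerivative (d ^ m) (map (algebraMap ℚ ℝ) f) k) := by
  obtain ⟨hmon, hdeg⟩ := monic_radialPoly (pow_pos hd m) (constantCoeff_map_eq_one hf hd) x
  rw [eval_radialDerivative]
  refine Polynomial.eval_one_iterate_derivative_pos k ?_ (by omega)
    (norm_lt_one_of_aeval_radialPoly_eq_zero hf hd hx hlt)
  rw [hmon.leadingCoeff]
  exact zero_lt_one

theorem aeval_pos_of_rootSum_lt_one
    (hf : expand d (map (algebraMap ℚ ℂ) f) = orbitProduct ℂ d (m + 1)) (hd : 0 < d)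
    {x : Fin (m + 1) → ℝ} (hx : 0 ≤ x) (hlt : rootSum d x < 1) : 0 < aeval x f := by
  have h := eval_radialDerivative_pos hf hd hx hlt (pow_pos hd m)
  have h1 := aeval_radialPoly ((totalDegree_map_of_injective (algebraMap ℚ ℝ).injective f).le.trans
    (totalDegree_eq_of_expand_eq_orbitProduct hf hd).le) x one_ne_zero
  simp only [one_pow, one_mul, div_one, aeval_map_algebraMap] at h1
  rw [eval_radialDerivative, Function.iterate_zero, id] at h
  have h2 := aeval_algebraMap_apply ℂ x f
  have h3 := Polynomial.aeval_algebraMap_apply_eq_algebraMap_eval (A := ℂ) (1 : ℝ)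
    ((radialPoly (d ^ m) (map (algebraMap ℚ ℝ) f)).map (eval x))
  rw [map_one, h1] at h3
  have h4 : algebraMap ℝ ℂ (aeval x f) = algebraMap ℝ ℂ _ := h2.symm.trans h3
  rw [(algebraMap ℝ ℂ).injective h4]
  exact h

theorem rootSum_le_one_of_radialDerivative_nonneg
    (hf : expand d (map (algebraMap ℚ ℂ) f) = orbitProduct ℂ d (m + 1)) (hd : 0 < d)
    {x : Fin (m + 1) → ℝ} (hx : 0 ≤ x)
    (h : ∀ k < d ^ m, 0 ≤ eval x (radialDerivative (d ^ m) (map (algebraMap ℚ ℝ) f) k)) :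
    rootSum d x ≤ 1 := by
  by_contra hlt
  rw [not_le] at hlt
  have hS : 0 < rootSum d x := by linarith
  obtain ⟨hmon, hdeg⟩ := monic_radialPoly (pow_pos hd m) (constantCoeff_map_eq_one hf hd) x
  have hpos := Polynomial.eval_pos_of_iterate_derivative_nonneg hmon
    (fun k hk => by rw [← eval_radialDerivative]; exact h k (by omega))
    (one_lt_pow₀ hlt hd.ne')
  -- Rescaling x to root sum 1 shows that S^d > 1 is a root of the radial polynomial.
  have hz : aeval (((rootSum d x) ^ d)⁻¹ • x) f = 0 := by
    refine aeval_eq_zero_of_rootSum_eq_one hf hd (smul_nonneg (by positivity) hx) ?_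
    rw [rootSum_smul (by positivity) hx, Real.inv_rpow (by positivity),
      Real.pow_rpow_inv_natCast hS.le hd.ne', inv_mul_cancel₀ hS.ne']
  have hne : ((rootSum d x ^ d : ℝ) : ℂ) ≠ 0 := by
    exact_mod_cast (pow_pos hS d).ne'
  have h1 := aeval_radialPoly ((totalDegree_map_of_injective (algebraMap ℚ ℝ).injective f).le.trans
    (totalDegree_eq_of_expand_eq_orbitProduct hf hd).le) x hne
  have h2 := aeval_algebraMap_apply ℂ (((rootSum d x) ^ d)⁻¹ • x) f
  have h3 : (algebraMap ℝ ℂ ∘ (((rootSum d x) ^ d)⁻¹ • x)) =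
      fun i => (x i : ℂ) / ((rootSum d x ^ d : ℝ) : ℂ) := by
    funext i
    simp [div_eq_inv_mul]
  rw [hz, map_zero] at h2
  have h4 : aeval (fun i => (x i : ℂ) / ((rootSum d x ^ d : ℝ) : ℂ)) f = 0 := by
    rw [← h3]
    exact h2
  rw [aeval_map_algebraMap, h4, mul_zero, ← Complex.coe_algebraMap,
    Polynomial.aeval_algebraMap_apply_eq_algebraMap_eval] at h1
  have h5 := (algebraMap ℝ ℂ).injective (h1.trans (map_zero _).symm)
  exact hpos.ne' h5

end OrbitPolynomial

/-! ### Polynomials vanishing on the boundary -/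

section Boundary

variable {m d : ℕ}

theorem eval_solveLast {k : Type*} [Field k] (a y : Fin (m + 1) → k)
    (p : MvPolynomial (Fin (m + 1)) k) :
    eval y (solveLast a p) = eval (Fin.snoc (fun i : Fin m => y i.castSucc)
      ((a (Fin.last m))⁻¹ * (1 - ∑ i : Fin m, a i.castSucc * y i.castSucc))) p := by
  rw [solveLast, map_aeval, coe_eval₂Hom]
  have h : (eval y).comp (algebraMap k (MvPolynomial (Fin (m + 1)) k)) = RingHom.id k := by
    ext c
    simp
  rw [h, eval₂_id]
  congr 1
  congr 1
  funext i
  induction i using Fin.lastCases with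
  | last => simp
  | cast i => simp

theorem affineForm_dvd_expand_of_vanishing {K : Type*} [Field K] [Algebra K ℝ] (hm : 1 ≤ m)
    (hd : 2 ≤ d) {g : MvPolynomial (Fin (m + 1)) K}
    (hg : ∀ x ∈ completableBoundary d (m + 1), aeval x g = 0) :
    affineForm 1 ∣ expand d (map ((algebraMap ℝ ℂ).comp (algebraMap K ℝ)) g) := by
  have hm0 : (0 : ℝ) < m := by exact_mod_cast hm
  rw [affineForm_dvd_iff (by exact one_ne_zero)]
  -- A box of infinite sets detects the zero polynomial. Side 1/m keeps the solved coordinate 1 - ∑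
  -- y_i nonnegative, so the point lies on the simplex.
  refine MvPolynomial.funext_set (fun _ => algebraMap ℝ ℂ '' Set.Icc 0 (m : ℝ)⁻¹)
    (fun _ => (Set.Icc_infinite (by positivity)).image (algebraMap ℝ ℂ).injective.injOn)
    fun y hy => ?_
  choose r hr hry using fun i => hy i (Set.mem_univ i)
  rw [map_zero, eval_solveLast, eval_expand, eval_map]
  let w : Fin (m + 1) → ℝ :=
    Fin.snoc (fun i : Fin m => r i.castSucc) (1 - ∑ i : Fin m, r i.castSucc)
  have hw0 : 0 ≤ w := by
    intro i
    induction i using Fin.lastCases with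
    | last =>
      have h1 : ∑ i : Fin m, r i.castSucc ≤ ∑ _i : Fin m, (m : ℝ)⁻¹ :=
        Finset.sum_le_sum fun i _ => (hr _).2
      have h2 : ∑ _i : Fin m, (m : ℝ)⁻¹ = 1 := by
        simp [hm0.ne']
      simp only [w, Fin.snoc_last, Pi.zero_apply]
      linarith
    | cast i => simpa [w] using (hr i.castSucc).1
  have hw1 : ∑ i, w i = 1 := by
    simp [w, Fin.sum_univ_castSucc]
  have h0 := hg (fun i => w i ^ d) (by
    rw [completableBoundary_eq hm hd]
    exact ⟨fun i => pow_nonneg (hw0 i) d, by rw [rootSum_pow (by omega) hw0, hw1]⟩)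
  rw [aeval_def] at h0
  have h1 := congrArg (algebraMap ℝ ℂ) h0
  rw [hom_eval₂, map_zero] at h1
  rw [← h1]
  congr 1
  funext i
  induction i using Fin.lastCases with
  | last => simp [w, ← hry]
  | cast i => simp [w, ← hry]

theorem isBoundaryPolynomial_and_unique {K : Type} [Field K] [Algebra K ℝ] (hm : 1 ≤ m)
    (hd : 2 ≤ d) {f : MvPolynomial (Fin (m + 1)) K}
    (hf : expand d (map ((algebraMap ℝ ℂ).comp (algebraMap K ℝ)) f) = orbitProduct ℂ d (m + 1))
    (hvan : ∀ x ∈ completableBoundary d (m + 1), aeval x f = 0) :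
    IsBoundaryPolynomial K d f ∧
      ∀ g : MvPolynomial (Fin (m + 1)) K, IsBoundaryPolynomial K d g → g = f := by
  have hd0 : 0 < d := by omega
  have hp := prime_of_expand_map_eq_orbitProduct _ hd0 hf
  have hc := expand_map_constantCoeff _ hd0 hf
  refine ⟨⟨hp.irreducible, hc, hvan⟩, fun g ⟨hgi, hgc, hgv⟩ => ?_⟩
  exact eq_of_dvd_of_irreducible hp.not_isUnit hc hgi hgc
    ((dvd_iff_affineForm_dvd_expand _ hd0 hf g).2 (affineForm_dvd_expand_of_vanishing hm hd hgv))

end Boundary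

/-- Here `n = m + 1` is the number of diagonal entries and `d` is the order of the tensors. -/
theorem proposition5p2 (m d : ℕ) (hm : 1 ≤ m) (hd : 2 ≤ d) :
    ∃ f : MvPolynomial (Fin (m + 1)) ℚ,
      -- existence and uniqueness, over the rationals and over the reals
      (IsBoundaryPolynomial ℚ d f ∧
        ∀ g : MvPolynomial (Fin (m + 1)) ℚ, IsBoundaryPolynomial ℚ d g → g = f) ∧
      (IsBoundaryPolynomial ℝ d (MvPolynomial.map (algebraMap ℚ ℝ) f) ∧
        ∀ g : MvPolynomial (Fin (m + 1)) ℝ, IsBoundaryPolynomial ℝ d g →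
          g = MvPolynomial.map (algebraMap ℚ ℝ) f) ∧
      -- the degree
      f.totalDegree = d ^ m ∧
      -- the product formula: the `d`-th roots of `x i` are the `ω i * y i` with `ω i ^ d = 1`
      (∀ (x : Fin (m + 1) → ℂ) (y : Fin m → ℂ), (∀ i, y i ^ d = x i.castSucc) →
        MvPolynomial.aeval x f =
          ∏ ω ∈ Fintype.piFinset (fun _ : Fin m => Polynomial.nthRootsFinset d (1 : ℂ)),
            ((1 - ∑ i, ω i * y i) ^ d - x (Fin.last m))) ∧
      -- the set is the closure of a chamber, and finitely many further polynomial inequalities,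
      -- which are strict on that chamber, separate it from all other chambers
      completableDiagonals d (m + 1) = closure (originChamber f) ∧
      ∃ (k : ℕ) (g : Fin k → MvPolynomial (Fin (m + 1)) ℝ),
        (∀ x ∈ originChamber f, ∀ j, 0 < MvPolynomial.eval x (g j)) ∧
        (∀ x : Fin (m + 1) → ℝ, 0 ≤ x → 0 < MvPolynomial.aeval x f → x ∉ originChamber f →
          ∃ j, MvPolynomial.eval x (g j) < 0) ∧
        completableDiagonals d (m + 1) =
          {x | 0 ≤ MvPolynomial.aeval x f ∧ (∀ i, 0 ≤ x i) ∧
            ∀ j, 0 ≤ MvPolynomial.eval x (g j)} := by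
  have hd0 : 0 < d := by omega
  obtain ⟨f, hf⟩ := exists_rat_expand_eq_orbitProduct hd0 (m + 1)
  have hzero : ∀ x : Fin (m + 1) → ℝ, 0 ≤ x → rootSum d x = 1 → aeval x f = 0 :=
    fun x hx h => aeval_eq_zero_of_rootSum_eq_one hf hd0 hx h
  have hpos : ∀ x : Fin (m + 1) → ℝ, 0 ≤ x → rootSum d x < 1 → 0 < aeval x f :=
    fun x hx h => aeval_pos_of_rootSum_lt_one hf hd0 hx h
  have hvan : ∀ x ∈ completableBoundary d (m + 1), aeval x f = 0 := fun x hx => by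
    rw [completableBoundary_eq hm hd] at hx
    exact hzero x hx.1 hx.2
  have hchamber := originChamber_eq hd0 hpos hzero
  have hclosure : completableDiagonals d (m + 1) = closure (originChamber f) := by
    rw [hchamber, closure_rootSum_lt_one hd0, completableDiagonals_eq hm hd]
  -- Derivatives of orders 0 to d^m - 1 suffice: the radial polynomial is monic of degree d^m, so
  -- the next one is a positive constant.
  refine ⟨f, ?_, ?_, totalDegree_eq_of_expand_eq_orbitProduct hf hd0,
    aeval_eq_prod_pow_sub hd0 hf, hclosure, d ^ m,
    fun k => radialDerivative (d ^ m) (map (algebraMap ℚ ℝ) f) k, ?_, ?_, ?_⟩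
  · refine isBoundaryPolynomial_and_unique hm hd ?_ hvan
    rw [← hf]
    exact congrArg (fun e => expand d (map e f)) (Subsingleton.elim _ _)
  · refine isBoundaryPolynomial_and_unique hm hd ?_ fun x hx => ?_
    · rw [← hf, map_map]
      exact congrArg (fun e => expand d (map e f)) (Subsingleton.elim _ _)
    · rw [aeval_map_algebraMap]
      exact hvan x hx
  · intro x hx j
    rw [hchamber] at hx
    exact eval_radialDerivative_pos hf hd0 hx.1 hx.2 j.2
  · intro x hx hfx hxU
    by_contra hneg
    push Not at hneg
    have hle := rootSum_le_one_of_radialDerivative_nonneg hf hd0 hx fun k hk => hneg ⟨k, hk⟩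
    rcases hle.lt_or_eq with h | h
    · exact hxU (by rw [hchamber]; exact ⟨hx, h⟩)
    · exact hfx.ne' (hzero x hx h)
  · refine Set.Subset.antisymm ?_ fun x hx => ?_
    · rw [hclosure]
      refine closure_minimal (fun x hx => ?_) ?_
      · have hx' := hx
        rw [hchamber] at hx'
        exact ⟨(hpos x hx'.1 hx'.2).le, hx'.1,
          fun j => (eval_radialDerivative_pos hf hd0 hx'.1 hx'.2 j.2).le⟩
      · have hcont : Continuous fun x : Fin (m + 1) → ℝ => aeval x f := by
          exact (MvPolynomial.continuous_eval (map (algebraMap ℚ ℝ) f)).congr fun x => by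
            rw [eval_map, aeval_def]
        have h1 := isClosed_le (continuous_const (y := (0 : ℝ))) hcont
        have h2 := isClosed_Ici (a := (0 : Fin (m + 1) → ℝ))
        have h3 := isClosed_iInter fun j : Fin (d ^ m) => isClosed_le
          (continuous_const (y := (0 : ℝ)))
          (MvPolynomial.continuous_eval (radialDerivative (d ^ m) (map (algebraMap ℚ ℝ) f) j))
        convert h1.inter (h2.inter h3) using 1
        ext x
        simp [Pi.le_def]
    · rw [completableDiagonals_eq hm hd]
      exact ⟨hx.2.1, rootSum_le_one_of_radialDerivative_nonneg hf hd0 hx.2.1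
        fun k hk => hx.2.2 ⟨k, hk⟩⟩
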